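/- Let $F\in\mathbb{C}[x,y]$ be an irreducible polynomial of positive degree in $y$, so that $F(w,w')=0$ is an irreducible first order algebraic differential equation with constant coefficients, where $w'=dw/dz$. A *rational general solution* of $F(w,w')=0$ is a rational function $w=w(z,\lambda)\in\mathbb{C}(z,\lambda)$ in which the arbitrary constant $\lambda$ really occurs ($w\notin\mathbb{C}(z)$) and such that $F(w,\partial w/\partial z)=0$; it is *non-constant* if it is not constant in $z$, i.e. $w\notin\mathbb{C}(\lambda)$. A *rational parametrization* of the curve $F(x,y)=0$ is a pair $\varphi,\psi\in\mathbb{C}(t)$ such that $(\varphi(t_0),\psi(t_0))$ is a point of the curve for all but finitely many $t_0\in\mathbb{C}$, and all but finitely many points of the curve are of the form $(\varphi(t_0),\psi(t_0))$ for exactly one $t_0\in\mathbb{C}$. Substituting $w=\varphi(t)$, $w'=\psi(t)$ turns $F(w,w')=0$ into the equation $t'=R(t)$ with $R=\psi/\frac{d\varphi}{dt}$. We say that $F(w,w')=0$ *is reduced along* $(\varphi,\psi)$ to $u'=S(u)$ if $t'=R(t)$ becomes $u'=S(u)$ under some change of variable $t=\alpha u+\beta$ with $\alpha,\beta\in\mathbb{C}$,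 $\alpha\neq0$. Then: 1. $F(w,w')=0$ has a non-constant rational general solution if and only if there is a rational parametrization of $F(x,y)=0$ along which the equation is reduced either to a linear equation $u'=c$ for some constant $c\in\mathbb{C}$, $c\neq 0$, or to the Riccati equation $u'+u^2=0$. 2. Moreover the choice of the parametrization does not matter: for every rational parametrization $(\varphi,\psi)$ of $F(x,y)=0$, the equation $F(w,w')=0$ has a non-constant rational general solution if and only if it is reduced along $(\varphi,\psi)$ either to $u'=c$ for some constant $c\neq0$ or to $u'+u^2=0$. 3. The Riccati equation $u'+u^2=0$ has the rational general solution $u=\dfrac{1}{z+\lambda}$. -/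

import Mathlib

noncomputable section

namespace FirstOrderADE

/-- The derivative of a rational function with respect to its (outer) variable,
by the quotient rule. -/
def ratDeriv {K : Type*} [Field K] (f : RatFunc K) : RatFunc K :=
  algebraMap (Polynomial K) (RatFunc K)
      (Polynomial.derivative f.num * f.denom - f.num * Polynomial.derivative f.denom) /
    algebraMap (Polynomial K) (RatFunc K) (f.denom ^ 2)

/-- The field `ℂ(z, λ)`, presented as `ℂ(λ)(z)`: the outer variable is `z`, the inner one is the
parameter `λ`. Hence `ratDeriv` on this field is `∂/∂z`. -/
abbrev RatZL : Type := RatFunc (RatFunc ℂ)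

/-- The variable `z` of `ℂ(z, λ)`. -/
def zVar : RatZL := RatFunc.X

/-- The parameter `λ` of `ℂ(z, λ)`. -/
def lamVar : RatZL := RatFunc.C RatFunc.X

/-- A rational function `v(z)` of one variable, regarded as an element of `ℂ(z, λ)` in which
`λ` does not occur. -/
def ofZ (v : RatFunc ℂ) : RatZL :=
  RatFunc.eval (RatFunc.C.comp RatFunc.C : ℂ →+* RatZL) zVar v

/-- `w(z, λ)` is a rational general solution of `F(w, w') = 0` (variable `0` of `F` stands for
`w`, variable `1` for `w'`): it is rational in `z` and `λ`, it solves the equation identically,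
and the arbitrary constant `λ` really occurs in it. -/
structure IsRationalGeneralSolution (F : MvPolynomial (Fin 2) ℂ) (w : RatZL) : Prop where
  solves : MvPolynomial.aeval ![w, ratDeriv w] F = 0
  depends : ∀ v : RatFunc ℂ, w ≠ ofZ v

/-- `w(z, λ)` is constant as a function of `z`, that is, it belongs to `ℂ(λ)`. -/
def IsConstantInZ (w : RatZL) : Prop :=
  ∃ a : RatFunc ℂ, w = RatFunc.C a

/-- `F(w, w') = 0` has a rational general solution that is not constant in `z`. -/
def HasNonconstantRationalGeneralSolution (F : MvPolynomial (Fin 2) ℂ) : Prop :=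
  ∃ w : RatZL, IsRationalGeneralSolution F w ∧ ¬ IsConstantInZ w

/-- The value of a rational function at a point (used only where it is defined). -/
def value (f : RatFunc ℂ) (t : ℂ) : ℂ := RatFunc.eval (RingHom.id ℂ) t f

/-- The rational function has no pole at `t`. -/
def DefinedAt (f : RatFunc ℂ) (t : ℂ) : Prop := f.denom.eval t ≠ 0

/-- `(φ, ψ)` is a rational parametrization of the plane curve `F(x, y) = 0`: all but finitely
many parameter values give a point of the curve, and all but finitely many points of the curve
come from exactly one parameter value. -/
structure IsRationalParametrization (F : MvPolynomial (Fin 2) ℂ) (φ ψ : RatFunc ℂ) : Prop where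
  on_curve : {t : ℂ | ¬ (DefinedAt φ t ∧ DefinedAt ψ t ∧
    MvPolynomial.eval ![value φ t, value ψ t] F = 0)}.Finite
  unique_param : {p : ℂ × ℂ | MvPolynomial.eval ![p.1, p.2] F = 0 ∧
    ¬ ∃! t : ℂ, DefinedAt φ t ∧ DefinedAt ψ t ∧ p.1 = value φ t ∧ p.2 = value ψ t}.Finite

/-- Substituting `w = φ(t)`, `w' = ψ(t)` turns `F(w, w') = 0` into the autonomous equation
`t' = R(t)` with `R = ψ / (dφ/dt)`. This is `R`. -/
def reducedRHS (φ ψ : RatFunc ℂ) : RatFunc ℂ := ψ / ratDeriv φ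

/-- Composition `f(g(u))` of rational functions, for non-constant `g`. -/
def ratComp (f g : RatFunc ℂ) : RatFunc ℂ := RatFunc.eval RatFunc.C g f

/-- A change of variable `t = α u + β`, with constants `α ≠ 0` and `β`, turns the equation
`t' = R(t)` into `u' = S(u)`. -/
def AffinelyReduces (R S : RatFunc ℂ) : Prop :=
  ∃ α β : ℂ, α ≠ 0 ∧
    ratComp R (RatFunc.C α * RatFunc.X + RatFunc.C β) / RatFunc.C α = S

/-- Along the parametrization `(φ, ψ)` and a constant affine change of variable, `F(w, w') = 0`
is reduced to `u' = c` for some constant `c ≠ 0`. -/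
def ReducesToLinear (φ ψ : RatFunc ℂ) : Prop :=
  ∃ c : ℂ, c ≠ 0 ∧ AffinelyReduces (reducedRHS φ ψ) (RatFunc.C c)

/-- Along the parametrization `(φ, ψ)` and a constant affine change of variable, `F(w, w') = 0`
is reduced to `u' + u ^ 2 = 0`. -/
def ReducesToRiccati (φ ψ : RatFunc ℂ) : Prop :=
  AffinelyReduces (reducedRHS φ ψ) (-RatFunc.X ^ 2)

end FirstOrderADE

end

noncomputable section

namespace FirstOrderADE

open Polynomial

/-! ### The derivation on rational functions -/

section Derivation

variable {K : Type*} [Field K]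

/-! The equation is autonomous, so a non-constant rational general solution exists exactly when some
non-constant `f` in ℂ(z) satisfies F(f, f') = 0: one direction specializes λ, the other shifts `f`
to f(z + λ) (`hasNonconstantRationalGeneralSolution_iff`).

Given such an `f`, differentiating F(f, f') = 0 expresses f'' through f and f', so E = ℂ(f, f') is a
differential field. It is larger than ℂ, hence z is algebraic over E, and since z' = 1 the minimal
polynomial argument of `mem_of_derivation_eq_one` puts z in E. Thus z = A(f, f') / B(f, f'), and (f,
f') is itself a rational parametrization, along which the equation reads t' = 1.

For an arbitrary parametrization (φ, ψ), put m = A(φ, ψ) / B(φ, ψ). Then φ = f ∘ m and ψ = f' ∘ m,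
so R = ψ / φ' = 1 / m'. Uniqueness of the parameter makes m injective off a finite set, so m = (at +
b) / (ct + d) (`natDegree_le_one_of_injOn`) and R = (ct + d)² / (ad - bc). This is a constant if c =
0, and an affine change of variable makes it -u² otherwise. Conversely, the solutions u = cz and u =
1/z of the reduced equations are carried back through φ. -/

theorem ratDeriv_div (p q : K[X]) (hq : q ≠ 0) :
    ratDeriv (algebraMap K[X] (RatFunc K) p / algebraMap K[X] (RatFunc K) q) =
      algebraMap K[X] (RatFunc K) (derivative p * q - p * derivative q) /
        algebraMap K[X] (RatFunc K) (q ^ 2) := by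
  have hinj := RatFunc.algebraMap_injective K
  set f := algebraMap K[X] (RatFunc K) p / algebraMap K[X] (RatFunc K) q with hf
  have hd : f.denom ≠ 0 := f.denom_ne_zero
  have h1 : f.num * q = p * f.denom := (RatFunc.num_mul_eq_mul_denom_iff hq).mpr rfl
  have h2 := congrArg derivative h1
  simp only [derivative_mul] at h2
  unfold ratDeriv
  rw [div_eq_div_iff (by simpa using hd) (by simpa using hq), ← map_mul, ← map_mul]
  congr 1
  linear_combination (f.denom * q) * h2 + (-derivative f.denom * q - f.denom * derivative q) * h1

theorem exists_eq_div (f : RatFunc K) : ∃ p q : K[X], q ≠ 0 ∧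
    f = algebraMap K[X] (RatFunc K) p / algebraMap K[X] (RatFunc K) q :=
  ⟨f.num, f.denom, f.denom_ne_zero, f.num_div_denom.symm⟩

theorem ratDeriv_algebraMap (p : K[X]) :
    ratDeriv (algebraMap K[X] (RatFunc K) p) = algebraMap K[X] (RatFunc K) (derivative p) := by
  simpa using ratDeriv_div p 1 one_ne_zero

theorem ratDeriv_C (a : K) : ratDeriv (RatFunc.C a) = 0 := by
  rw [← RatFunc.algebraMap_C, ratDeriv_algebraMap]; simp

theorem ratDeriv_X : ratDeriv (RatFunc.X : RatFunc K) = 1 := by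
  rw [← RatFunc.algebraMap_X, ratDeriv_algebraMap]; simp

theorem ratDeriv_add (f g : RatFunc K) : ratDeriv (f + g) = ratDeriv f + ratDeriv g := by
  obtain ⟨p, q, hq, rfl⟩ := exists_eq_div f
  obtain ⟨r, s, hs, rfl⟩ := exists_eq_div g
  have hq' : algebraMap K[X] (RatFunc K) q ≠ 0 := by simpa using hq
  have hs' : algebraMap K[X] (RatFunc K) s ≠ 0 := by simpa using hs
  rw [div_add_div _ _ hq' hs', ← map_mul, ← map_mul, ← map_mul, ← map_add,
    ratDeriv_div _ _ (mul_ne_zero hq hs), ratDeriv_div _ _ hq, ratDeriv_div _ _ hs]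
  simp only [derivative_mul, map_mul, map_add, map_sub, map_pow]
  field_simp
  ring

theorem ratDeriv_mul (f g : RatFunc K) :
    ratDeriv (f * g) = f * ratDeriv g + g * ratDeriv f := by
  obtain ⟨p, q, hq, rfl⟩ := exists_eq_div f
  obtain ⟨r, s, hs, rfl⟩ := exists_eq_div g
  have hq' : algebraMap K[X] (RatFunc K) q ≠ 0 := by simpa using hq
  have hs' : algebraMap K[X] (RatFunc K) s ≠ 0 := by simpa using hs
  rw [div_mul_div_comm, ← map_mul, ← map_mul,
    ratDeriv_div _ _ (mul_ne_zero hq hs), ratDeriv_div _ _ hq, ratDeriv_div _ _ hs]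
  simp only [derivative_mul, map_mul, map_add, map_sub, map_pow]
  field_simp
  ring

variable (K) in
/-- `ratDeriv` as a derivation over the field of constants. -/
def ratDerivation : Derivation K (RatFunc K) (RatFunc K) where
  toFun := ratDeriv
  map_add' := ratDeriv_add
  map_smul' a f := by
    simp [RatFunc.smul_eq_C_mul, ratDeriv_mul, ratDeriv_C]
  map_one_eq_zero' := by simpa using ratDeriv_C (1 : K)
  leibniz' := ratDeriv_mul

@[simp] theorem ratDerivation_apply (f : RatFunc K) : ratDerivation K f = ratDeriv f := rfl

/-- For p / q in lowest terms, p'q = pq' gives q ∣ q'; by degrees q' = 0, and then p' = 0. -/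
theorem ratDeriv_eq_zero_iff [CharZero K] {f : RatFunc K} :
    ratDeriv f = 0 ↔ ∃ a, f = RatFunc.C a := by
  refine ⟨fun h => ?_, fun ⟨a, ha⟩ => ha ▸ ratDeriv_C a⟩
  have hd := f.denom_ne_zero
  have h1 : derivative f.num * f.denom = f.num * derivative f.denom := by
    have : algebraMap K[X] (RatFunc K)
        (derivative f.num * f.denom - f.num * derivative f.denom) = 0 := by
      unfold ratDeriv at h
      rw [div_eq_zero_iff] at h
      exact h.resolve_right (by simpa using hd)
    rw [map_eq_zero_iff _ (RatFunc.algebraMap_injective K)] at this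
    exact sub_eq_zero.mp this
  have hcop := f.isCoprime_num_denom
  have h2 : f.denom ∣ derivative f.denom :=
    hcop.symm.dvd_of_dvd_mul_left (Dvd.intro_left _ h1)
  have h3 : derivative f.denom = 0 := by
    by_contra hne
    exact absurd (degree_le_of_dvd h2 hne) (not_le.mpr (degree_derivative_lt hd))
  have h4 : derivative f.num = 0 := by
    rw [h3, mul_zero] at h1
    exact (mul_eq_zero.mp h1).resolve_right hd
  have h5 := derivative_eq_zero.mp h3
  have h6 := derivative_eq_zero.mp h4
  rw [natDegree_eq_zero] at h5 h6
  obtain ⟨a, ha⟩ := h6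
  obtain ⟨b, hb⟩ := h5
  refine ⟨a / b, ?_⟩
  rw [← f.num_div_denom, ← ha, ← hb]
  simp

end Derivation

/-! ### Substitution into rational functions -/

section Substitution

variable {k : Type*} [Field k]

theorem aeval_ne_zero_of_transcendental {A : Type*} [Field A] [Algebra k A] {g : A}
    (hg : Transcendental k g) {p : k[X]} (hp : p ≠ 0) : aeval g p ≠ 0 := fun h =>
  hp ((transcendental_iff.mp hg) p h)

/-- Substitution of a transcendental element into rational functions. -/
def subst {A : Type*} [Field A] [Algebra k A] (g : A) (hg : Transcendental k g) :
    RatFunc k →ₐ[k] A :=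
  RatFunc.liftAlgHom (aeval g) fun _ hp => mem_nonZeroDivisors_of_ne_zero
    (aeval_ne_zero_of_transcendental hg (nonZeroDivisors.ne_zero hp))

variable {A : Type*} [Field A] [Algebra k A] {g : A} (hg : Transcendental k g)

theorem subst_apply (f : RatFunc k) :
    subst g hg f = aeval g f.num / aeval g f.denom := RatFunc.liftAlgHom_apply ..

theorem subst_algebraMap (p : k[X]) :
    subst g hg (algebraMap k[X] (RatFunc k) p) = aeval g p := by
  have := RatFunc.liftAlgHom_apply_div (aeval g) (fun _ hp => mem_nonZeroDivisors_of_ne_zero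
    (aeval_ne_zero_of_transcendental hg (nonZeroDivisors.ne_zero hp))) p 1
  simpa [subst] using this

theorem subst_X : subst g hg RatFunc.X = g := by
  rw [← RatFunc.algebraMap_X, subst_algebraMap, aeval_X]

theorem subst_C (a : k) : subst g hg (RatFunc.C a) = algebraMap k A a := by
  rw [← RatFunc.algebraMap_C, subst_algebraMap, aeval_C]

/-- The chain rule. -/
theorem ratDeriv_subst {L : Type*} [Field L] [Algebra k L] {g : RatFunc L}
    (hg : Transcendental k g) (f : RatFunc k) :
    ratDeriv (subst g hg f) = subst g hg (ratDeriv f) * ratDeriv g := by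
  have hpoly (p : k[X]) : ratDeriv (aeval g p) = aeval g (derivative p) * ratDeriv g :=
    Derivation.comp_aeval_eq g ((ratDerivation L).restrictScalars k) p
  obtain ⟨p, q, hq, rfl⟩ := exists_eq_div f
  have hq' := aeval_ne_zero_of_transcendental hg hq
  have hdiv : ratDeriv (aeval g p / aeval g q) = _ := (ratDerivation L).leibniz_div _ _
  rw [ratDeriv_div p q hq, map_div₀, map_div₀, subst_algebraMap, subst_algebraMap,
    subst_algebraMap, subst_algebraMap, hdiv]
  simp only [ratDerivation_apply, hpoly, smul_eq_mul, map_sub, map_mul, map_pow]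
  field_simp

end Substitution

/-! ### Differential subfields of `k(z)` -/

section DifferentialSubfield

variable {k L : Type*} [Field k] [Field L] [Algebra k L]

/-- The polynomial `q` is `p` with `D` applied to its coefficients; stability of `E` under `D` keeps
it over `E`. -/
theorem exists_derivation_aeval (D : Derivation k L L) (E : IntermediateField k L)
    (hE : ∀ x ∈ E, D x ∈ E) (z : L) (p : E[X]) :
    ∃ q : E[X], (∀ i, (q.coeff i : L) = D (p.coeff i)) ∧
      D (aeval z p) = aeval z q + aeval z (derivative p) * D z := by
  induction p using Polynomial.induction_on' with
  | add p q hp hq =>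
    obtain ⟨p', hp1, hp2⟩ := hp
    obtain ⟨q', hq1, hq2⟩ := hq
    refine ⟨p' + q', fun i => by simp [hp1, hq1], ?_⟩
    simp only [map_add, hp2, hq2]
    ring
  | monomial n a =>
    refine ⟨monomial n ⟨D a, hE _ a.2⟩, fun i => ?_, ?_⟩
    · rw [coeff_monomial, coeff_monomial]
      split_ifs <;> simp
    · simp only [aeval_monomial, derivative_monomial, Derivation.leibniz, Derivation.leibniz_pow,
        smul_eq_mul, map_mul, map_natCast, nsmul_eq_mul]
      simp only [IntermediateField.algebraMap_apply]
      ring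

/-- Applying `D` to p(z) = 0, with `p` the minimal polynomial of degree n + 1, gives a relation of
smaller degree because the leading coefficient 1 is killed. That relation is therefore trivial, and
its coefficient of degree n says that (n + 1)z + pₙ is a constant of `D`. -/
theorem mem_of_derivation_eq_one [CharZero k] (D : Derivation k L L)
    (hD : ∀ x, D x = 0 → x ∈ (algebraMap k L).range) (E : IntermediateField k L)
    (hE : ∀ x ∈ E, D x ∈ E) {z : L} (hz : D z = 1) (halg : IsAlgebraic E z) : z ∈ E := by
  have hint : IsIntegral E z := halg.isIntegral
  have : CharZero L := charZero_of_injective_algebraMap (algebraMap k L).injective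
  set p := minpoly E z with hp
  have hmon : p.Monic := minpoly.monic hint
  have hpos : 0 < p.natDegree := minpoly.natDegree_pos hint
  obtain ⟨q, hq1, hq2⟩ := exists_derivation_aeval D E hE z p
  obtain ⟨n, hn⟩ : ∃ n, p.natDegree = n + 1 := ⟨p.natDegree - 1, by omega⟩
  have h0 : aeval z (q + derivative p) = 0 := by
    have h1 : aeval z p = 0 := minpoly.aeval E z
    rw [h1, map_zero, hz, mul_one] at hq2
    rw [map_add, ← hq2]
  have hdeg : (q + derivative p).degree < p.degree := by
    rw [degree_eq_natDegree hmon.ne_zero, degree_lt_iff_coeff_zero]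
    intro m hm
    rw [coeff_add, coeff_derivative, coeff_eq_zero_of_natDegree_lt (by omega : p.natDegree < m + 1),
      zero_mul, add_zero]
    apply Subtype.ext
    rw [hq1]
    rcases hm.eq_or_lt with h | h
    · rw [← h, hmon.coeff_natDegree]; simp
    · rw [coeff_eq_zero_of_natDegree_lt h]; simp
  have hzero : q + derivative p = 0 := by
    by_contra hne
    exact absurd (minpoly.degree_le_of_ne_zero E z hne h0) (not_le.mpr hdeg)
  have hcoef : D (p.coeff n : L) = -(n + 1 : L) := by
    have h1 := congrArg (fun r : E[X] => (r.coeff n : L)) hzero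
    simp only [coeff_add, coeff_derivative, ← hn, hmon.coeff_natDegree, one_mul] at h1
    push_cast at h1
    rw [hq1] at h1
    simpa using eq_neg_of_add_eq_zero_left h1
  have hn1 : (n + 1 : L) ≠ 0 := by exact_mod_cast Nat.succ_ne_zero n
  have hker : D (((n + 1 : ℕ) : L) * z + p.coeff n) = 0 := by
    rw [map_add, Derivation.leibniz, hcoef, hz, Derivation.map_natCast]
    simp
  obtain ⟨c, hc⟩ := hD _ hker
  have hz' : z = (algebraMap k L c - p.coeff n) / ((n + 1 : ℕ) : L) := by
    rw [hc]; push_cast; field_simp; ring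
  rw [hz']
  exact E.div_mem (E.sub_mem (E.algebraMap_mem c) (p.coeff n).2) (natCast_mem E _)

theorem derivation_mem_adjoin (D : Derivation k L L) {S : Set L}
    (hS : ∀ x ∈ S, D x ∈ IntermediateField.adjoin k S) :
    ∀ x ∈ IntermediateField.adjoin k S, D x ∈ IntermediateField.adjoin k S := by
  intro x hx
  induction hx using IntermediateField.adjoin_induction with
  | mem x hx => exact hS x hx
  | algebraMap x => simp
  | add x y _ _ h1 h2 => rw [map_add]; exact add_mem h1 h2
  | inv x hx h =>
    rw [Derivation.leibniz_inv]
    exact mul_mem (neg_mem (pow_mem (inv_mem hx) 2)) h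
  | mul x y hx hy h1 h2 =>
    rw [Derivation.leibniz]
    exact add_mem (mul_mem hx h2) (mul_mem hy h1)

theorem derivation_aeval_pair (D : Derivation k L L) (x y : L) (F : MvPolynomial (Fin 2) k) :
    D (MvPolynomial.aeval ![x, y] F) =
      MvPolynomial.aeval ![x, y] (MvPolynomial.pderiv 0 F) * D x +
        MvPolynomial.aeval ![x, y] (MvPolynomial.pderiv 1 F) * D y := by
  induction F using MvPolynomial.induction_on with
  | C a => simp
  | add p q hp hq => simp only [map_add, hp, hq]; ring
  | mul_X p i hp =>
    fin_cases i <;> simp [Derivation.leibniz, hp, MvPolynomial.pderiv_X] <;> ring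

end DifferentialSubfield

/-! ### Irreducible plane curves -/

section PlaneCurve

variable {k : Type*} [Field k]

theorem degreeOf_one_aeval_X_zero (p : k[X]) :
    MvPolynomial.degreeOf 1 (aeval (MvPolynomial.X 0 : MvPolynomial (Fin 2) k) p) = 0 := by
  induction p using Polynomial.induction_on' with
  | add p q hp hq =>
    rw [map_add]
    exact Nat.le_zero.mp ((MvPolynomial.degreeOf_add_le _ _ _).trans (by simp [hp, hq]))
  | monomial n a =>
    rw [aeval_monomial]
    refine Nat.le_zero.mp ((MvPolynomial.degreeOf_mul_le _ _ _).trans ?_)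
    have h1 : MvPolynomial.degreeOf 1 (algebraMap k (MvPolynomial (Fin 2) k) a) = 0 :=
      MvPolynomial.degreeOf_C _ _
    rw [h1, zero_add]
    refine (MvPolynomial.degreeOf_pow_le _ _ _).trans ?_
    rw [MvPolynomial.degreeOf_X_of_ne (by decide)]
    simp

theorem equivMvPolynomial_C (r : k[X]) :
    Bivariate.equivMvPolynomial k (C r) = aeval (MvPolynomial.X 0) r := by
  simp only [Bivariate.equivMvPolynomial, AlgEquiv.ofAlgHom_apply, aevalAeval_C]

/-- Inside k[x][y] the outer variable is variable 1 of `F`; positive degree there makes Gauss's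
lemma available. -/
theorem natDegree_symm_pos {F : MvPolynomial (Fin 2) k} (hord : 0 < F.degreeOf 1) :
    0 < ((Bivariate.equivMvPolynomial k).symm F).natDegree := by
  by_contra h
  obtain ⟨p, hp⟩ := natDegree_eq_zero.mp (Nat.le_zero.mp (not_lt.mp h))
  have : F = aeval (MvPolynomial.X 0) p := by
    rw [← equivMvPolynomial_C, hp, AlgEquiv.apply_symm_apply]
  rw [this, degreeOf_one_aeval_X_zero] at hord
  exact lt_irrefl _ hord

/-- Elimination of the second variable. -/
theorem exists_eliminant {F G : MvPolynomial (Fin 2) k} (hF : Irreducible F)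
    (hord : 0 < F.degreeOf 1) (hG : ¬ F ∣ G) :
    ∃ (r : k[X]) (u v : MvPolynomial (Fin 2) k), r ≠ 0 ∧
      u * F + v * G = aeval (MvPolynomial.X 0) r := by
  set e := Bivariate.equivMvPolynomial k
  set f := e.symm F with hf
  set g := e.symm G with hg
  have hfirr : Irreducible f := (MulEquiv.irreducible_iff e.symm.toMulEquiv).mpr hF
  have hfdeg : 0 < f.natDegree := natDegree_symm_pos hord
  have hprim : f.IsPrimitive := hfirr.isPrimitive hfdeg.ne'
  have hndvd : ¬ f ∣ g := fun h => hG (by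
    have := map_dvd e h
    simpa [hf, hg] using this)
  -- By Gauss's lemma irreducibility and non-divisibility persist over k(x), where they yield a
  -- Bézout identity; clearing its denominators gives the eliminant.
  let φ := algebraMap k[X] (RatFunc k)
  have hirr : Irreducible (f.map φ) :=
    hprim.irreducible_iff_irreducible_map_fraction_map.mp hfirr
  have hndvd' : ¬ f.map φ ∣ g.map φ := fun h =>
    hndvd (hprim.dvd_of_fraction_map_dvd_fraction_map h)
  obtain ⟨u, v, huv⟩ := (hirr.coprime_iff_not_dvd.mpr hndvd' : IsCoprime (f.map φ) (g.map φ))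
  obtain ⟨b, hb, hb'⟩ := IsLocalization.integerNormalization_spec (nonZeroDivisors k[X]) u
  obtain ⟨c, hc, hc'⟩ := IsLocalization.integerNormalization_spec (nonZeroDivisors k[X]) v
  set u' := IsLocalization.integerNormalization (nonZeroDivisors k[X]) u
  set v' := IsLocalization.integerNormalization (nonZeroDivisors k[X]) v
  have hkey : C c * u' * f + C b * v' * g = C (b * c) := by
    apply map_injective φ (RatFunc.algebraMap_injective k)
    simp only [Polynomial.map_add, Polynomial.map_mul, map_C]
    have e1 : u'.map φ = C (φ b) * u := by rw [hb', Algebra.smul_def]; rfl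
    have e2 : v'.map φ = C (φ c) * v := by rw [hc', Algebra.smul_def]; rfl
    rw [e1, e2, map_mul, C_mul]
    linear_combination (C (φ b) * C (φ c)) * huv
  refine ⟨b * c, e (C c * u'), e (C b * v'),
    mul_ne_zero (nonZeroDivisors.ne_zero hb) (nonZeroDivisors.ne_zero hc), ?_⟩
  rw [← equivMvPolynomial_C, ← hkey]
  simp [hf, hg, e]

/-- The y-derivative is non-zero in characteristic zero and has smaller y-degree. -/
theorem not_dvd_pderiv_one [CharZero k] {F : MvPolynomial (Fin 2) k}
    (hord : 0 < F.degreeOf 1) : ¬ F ∣ MvPolynomial.pderiv 1 F := by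
  set f := (Bivariate.equivMvPolynomial k).symm F with hf
  have hfdeg : 0 < f.natDegree := natDegree_symm_pos hord
  have hF : F = Bivariate.equivMvPolynomial k f := by simp [hf]
  rw [hF, Bivariate.pderiv_one_equivMvPolynomial]
  intro h
  have h' := map_dvd (Bivariate.equivMvPolynomial k).symm h
  simp only [AlgEquiv.symm_apply_apply] at h'
  have hne : derivative f ≠ 0 := fun h0 => by
    have := derivative_eq_zero.mp h0
    omega
  have hf0 : f ≠ 0 := by rintro h0; simp [h0] at hfdeg
  exact absurd (degree_le_of_dvd h' hne) (not_le.mpr (degree_derivative_lt hf0))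

/-- The kernel of a non-degenerate point of the curve is generated by its equation. -/
theorem dvd_of_aeval_eq_zero {L : Type*} [Field L] [Algebra k L] {F G : MvPolynomial (Fin 2) k}
    (hF : Irreducible F) (hord : 0 < F.degreeOf 1) {x y : L} (hx : Transcendental k x)
    (hFxy : MvPolynomial.aeval ![x, y] F = 0) (hG : MvPolynomial.aeval ![x, y] G = 0) :
    F ∣ G := by
  by_contra h
  obtain ⟨r, u, v, hr, huv⟩ := exists_eliminant hF hord h
  have h1 := congrArg (MvPolynomial.aeval ![x, y]) huv
  rw [map_add, map_mul, map_mul, hFxy, hG, mul_zero, mul_zero, add_zero,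
    ← Polynomial.aeval_algHom_apply, MvPolynomial.aeval_X] at h1
  exact aeval_ne_zero_of_transcendental hx hr h1.symm

theorem eval_pair_eq_evalEval {R : Type*} [CommRing R] (F : MvPolynomial (Fin 2) R) (x y : R) :
    MvPolynomial.eval ![x, y] F = ((Bivariate.equivMvPolynomial R).symm F).evalEval x y := by
  induction F using MvPolynomial.induction_on with
  | C a => simp
  | add p q hp hq => simp [hp, hq]
  | mul_X p i hp => fin_cases i <;> simp [hp, evalEval_C]

/-- If F(x, ·) vanished identically, `X - C x` would divide all the coefficients of a primitive
polynomial. -/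
theorem finite_fiber {F : MvPolynomial (Fin 2) k} (hF : Irreducible F)
    (hord : 0 < F.degreeOf 1) (x : k) :
    {y : k | MvPolynomial.eval ![x, y] F = 0}.Finite := by
  classical
  set f := (Bivariate.equivMvPolynomial k).symm F with hf
  have hfirr : Irreducible f :=
    (MulEquiv.irreducible_iff (Bivariate.equivMvPolynomial k).symm.toMulEquiv).mpr hF
  have hprim : f.IsPrimitive := hfirr.isPrimitive (natDegree_symm_pos hord).ne'
  have hne : f.map (evalRingHom x) ≠ 0 := by
    intro h
    refine not_isUnit_X_sub_C x (hprim _ ((C_dvd_iff_dvd_coeff _ _).mpr fun i => ?_))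
    rw [dvd_iff_isRoot, IsRoot.def]
    simpa using congrArg (fun g => coeff g i) h
  refine (f.map (evalRingHom x)).roots.toFinset.finite_toSet.subset fun y hy => ?_
  rw [Set.mem_ofPred_eq, eval_pair_eq_evalEval, ← hf, ← map_evalRingHom_eval] at hy
  simpa [hne] using hy

/-- Two curves without common component meet in finitely many points. -/
theorem finite_common_zeros {F G : MvPolynomial (Fin 2) k} (hF : Irreducible F)
    (hord : 0 < F.degreeOf 1) (hG : ¬ F ∣ G) :
    {p : k × k | MvPolynomial.eval ![p.1, p.2] F = 0 ∧
      MvPolynomial.eval ![p.1, p.2] G = 0}.Finite := by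
  classical
  obtain ⟨r, u, v, hr, huv⟩ := exists_eliminant hF hord hG
  have hfin : (⋃ x ∈ (r.roots.toFinset : Set k),
      (fun y => (x, y)) '' {y : k | MvPolynomial.eval ![x, y] F = 0}).Finite :=
    r.roots.toFinset.finite_toSet.biUnion fun x _ => (finite_fiber hF hord x).image _
  refine hfin.subset ?_
  rintro ⟨x, y⟩ ⟨h1, h2⟩
  have h3 := congrArg (MvPolynomial.eval ![x, y]) huv
  simp only at h1 h2
  rw [map_add, map_mul, map_mul, h1, h2, mul_zero, mul_zero, add_zero] at h3
  have h4 : r.eval x = 0 := by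
    rw [← MvPolynomial.aeval_eq_eval, ← Polynomial.aeval_algHom_apply,
      MvPolynomial.aeval_X] at h3
    simpa using h3.symm
  simp only [Set.mem_iUnion]
  exact ⟨x, by simpa [hr] using h4, y, h1, rfl⟩

end PlaneCurve

/-! ### Specialization of polynomial relations between fractions -/

section Specialization

universe u

variable {k : Type*} [Field k] {s : Type*} {R : Type*} [CommRing R] [Algebra k R]

/-- The exponent and the cleared numerator `H` do not depend on `σ`, so one `H` can be compared
under two different homomorphisms. -/
theorem exists_homogenization (G : MvPolynomial s k) (a : s → R) (q : R) :
    ∃ (n : ℕ) (H : R), ∀ {L : Type u} [Field L] [Algebra k L] (σ : R →ₐ[k] L), σ q ≠ 0 →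
      MvPolynomial.aeval (fun i => σ (a i) / σ q) G * σ q ^ n = σ H := by
  induction G using MvPolynomial.induction_on with
  | C c => exact ⟨0, algebraMap k R c, fun σ _ => by simp⟩
  | add G₁ G₂ h₁ h₂ =>
    obtain ⟨n₁, H₁, h₁⟩ := h₁
    obtain ⟨n₂, H₂, h₂⟩ := h₂
    refine ⟨n₁ + n₂, H₁ * q ^ n₂ + H₂ * q ^ n₁, fun σ hσ => ?_⟩
    simp only [map_add, map_mul, map_pow, ← h₁ σ hσ, ← h₂ σ hσ]
    ring
  | mul_X G i h =>
    obtain ⟨n, H, h⟩ := h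
    refine ⟨n + 1, H * a i, fun σ hσ => ?_⟩
    simp only [map_mul, MvPolynomial.aeval_X, ← h σ hσ]
    field_simp
    ring

/-- The relation between fractions says that a single element `H` lies in the kernel of `ι`, hence
in that of `σ`. It serves for evaluating at a parameter value, for moving to another point of the
curve and for specializing λ. -/
theorem aeval_eq_zero_of_specialization {L₁ L₂ : Type u} [Field L₁] [Algebra k L₁] [Field L₂]
    [Algebra k L₂] (ι : R →ₐ[k] L₁) (σ : R →ₐ[k] L₂) (hισ : ∀ r, ι r = 0 → σ r = 0)
    {a : s → R} {q : R} (hq : σ q ≠ 0) {G : MvPolynomial s k}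
    (hG : MvPolynomial.aeval (fun i => ι (a i) / ι q) G = 0) :
    MvPolynomial.aeval (fun i => σ (a i) / σ q) G = 0 := by
  obtain ⟨n, H, h⟩ := exists_homogenization.{u} G a q
  have h1 := h ι (fun h0 => hq (hισ q h0))
  rw [hG, zero_mul] at h1
  have h2 := h σ hq
  rw [hισ H h1.symm] at h2
  exact (mul_eq_zero.mp h2).resolve_right (pow_ne_zero _ hq)

end Specialization

/-! ### Values of rational functions -/

section Values

variable {s : Type*} [Fintype s]

theorem value_eq (f : RatFunc ℂ) (t : ℂ) : value f t = f.num.eval t / f.denom.eval t := by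
  simp [value, RatFunc.eval, eval₂_id]

theorem finite_not_definedAt (f : RatFunc ℂ) : {t | ¬ DefinedAt f t}.Finite := by
  refine f.denom.roots.toFinset.finite_toSet.subset fun t ht => ?_
  simpa [DefinedAt, f.denom_ne_zero] using ht

/-- The product of the reduced denominators vanishes only at poles of some `w i`. -/
theorem exists_common_denom (w : s → RatFunc ℂ) : ∃ (a : s → ℂ[X]) (q : ℂ[X]), q ≠ 0 ∧
    (∀ i, w i = algebraMap ℂ[X] (RatFunc ℂ) (a i) / algebraMap ℂ[X] (RatFunc ℂ) q) ∧
    ∀ t, (∀ i, DefinedAt (w i) t) → q.eval t ≠ 0 ∧ ∀ i, value (w i) t = (a i).eval t / q.eval t := by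
  classical
  have hq (i : s) : ∏ j, (w j).denom = (w i).denom * ∏ j ∈ Finset.univ.erase i, (w j).denom :=
    (Finset.mul_prod_erase _ _ (Finset.mem_univ i)).symm
  have hne : ∏ j, (w j).denom ≠ 0 := Finset.prod_ne_zero_iff.mpr fun i _ => (w i).denom_ne_zero
  refine ⟨fun i => (w i).num * ∏ j ∈ Finset.univ.erase i, (w j).denom, ∏ j, (w j).denom,
    hne, fun i => ?_, fun t ht => ?_⟩
  · have h := hne
    rw [hq i] at h ⊢
    rw [map_mul, map_mul, mul_div_mul_right _ _ (RatFunc.algebraMap_ne_zero (right_ne_zero_of_mul h)),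
      RatFunc.num_div_denom]
  · have h : (∏ j, (w j).denom).eval t ≠ 0 := by
      rw [eval_prod]
      exact Finset.prod_ne_zero_iff.mpr fun i _ => ht i
    refine ⟨h, fun i => ?_⟩
    rw [hq i, eval_mul] at h ⊢
    rw [eval_mul, mul_div_mul_right _ _ (right_ne_zero_of_mul h), value_eq]

theorem eval_value_eq_zero {w : s → RatFunc ℂ} {G : MvPolynomial s ℂ}
    (hG : MvPolynomial.aeval w G = 0) {t : ℂ} (ht : ∀ i, DefinedAt (w i) t) :
    MvPolynomial.eval (fun i => value (w i) t) G = 0 := by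
  obtain ⟨a, q, hq, haq, hval⟩ := exists_common_denom w
  obtain ⟨h1, h2⟩ := hval t ht
  rw [← MvPolynomial.aeval_eq_eval, funext h2]
  have h3 := aeval_eq_zero_of_specialization (IsScalarTower.toAlgHom ℂ ℂ[X] (RatFunc ℂ))
    (aeval t : ℂ[X] →ₐ[ℂ] ℂ) (fun r hr => by
      have : r = 0 := by simpa using hr
      simp [this]) (a := a) (q := q) (G := G) (by simpa using h1) (by
      simpa [← haq] using hG)
  simpa [coe_aeval_eq_eval] using h3

/-- The cleared numerator is a polynomial with infinitely many roots. -/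
theorem aeval_eq_zero_of_infinite {w : s → RatFunc ℂ} {G : MvPolynomial s ℂ}
    (hG : {t | (∀ i, DefinedAt (w i) t) ∧
      MvPolynomial.eval (fun i => value (w i) t) G = 0}.Infinite) :
    MvPolynomial.aeval w G = 0 := by
  obtain ⟨a, q, hq, haq, hval⟩ := exists_common_denom w
  obtain ⟨n, H, h⟩ := exists_homogenization.{0} G a q
  have hq' : algebraMap ℂ[X] (RatFunc ℂ) q ≠ 0 := by simpa using hq
  have hH : H = 0 := by
    refine eq_zero_of_infinite_isRoot H (hG.mono ?_)
    rintro t ⟨ht, h0⟩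
    obtain ⟨h1, h2⟩ := hval t ht
    have h3 := h (aeval t : ℂ[X] →ₐ[ℂ] ℂ) (by simpa using h1)
    rw [← MvPolynomial.aeval_eq_eval, funext h2] at h0
    simp only [coe_aeval_eq_eval] at h3
    rw [h0, zero_mul] at h3
    exact h3.symm
  have h4 := h (IsScalarTower.toAlgHom ℂ ℂ[X] (RatFunc ℂ)) (by simpa using hq)
  simp only [IsScalarTower.coe_toAlgHom', ← haq, hH, map_zero] at h4
  exact (mul_eq_zero.mp h4).resolve_right (pow_ne_zero _ hq')

theorem finite_value_eq {f : RatFunc ℂ} (hf : ¬ ∃ a, f = RatFunc.C a) (c : ℂ) :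
    {t | DefinedAt f t ∧ value f t = c}.Finite := by
  by_contra hinf
  have h := aeval_eq_zero_of_infinite (w := fun _ : Unit => f)
    (G := MvPolynomial.X () - MvPolynomial.C c) (Set.Infinite.mono (fun t ht => by
      obtain ⟨h1, h2⟩ := ht
      exact ⟨fun _ => h1, by simp [h2]⟩) hinf)
  refine hf ⟨c, ?_⟩
  simpa [sub_eq_zero] using h

end Values

/-! ### Inverting a parametrization -/

section Inverse

variable {F : MvPolynomial (Fin 2) ℂ}

/-- A non-constant solution `f ∈ ℂ(z)` generates, together with its derivative, the field `ℂ(z)`. -/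
theorem exists_inverse_of_solution (hF : Irreducible F) (hord : 0 < F.degreeOf 1) {f : RatFunc ℂ}
    (hf : ratDeriv f ≠ 0) (hFf : MvPolynomial.aeval ![f, ratDeriv f] F = 0) :
    ∃ A B : MvPolynomial (Fin 2) ℂ, MvPolynomial.aeval ![f, ratDeriv f] B ≠ 0 ∧
      RatFunc.X = MvPolynomial.aeval ![f, ratDeriv f] A / MvPolynomial.aeval ![f, ratDeriv f] B := by
  have hconst : ¬ ∃ a, f = RatFunc.C a := fun h => hf (ratDeriv_eq_zero_iff.mpr h)
  have htr : Transcendental ℂ f := RatFunc.transcendental_of_ne_C f hconst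
  set S : Set (RatFunc ℂ) := Set.range ![f, ratDeriv f] with hS
  set E := IntermediateField.adjoin ℂ S with hE
  have hmem (G : MvPolynomial (Fin 2) ℂ) : MvPolynomial.aeval ![f, ratDeriv f] G ∈ E :=
    (IntermediateField.mem_adjoin_range_iff ℂ _ _).mpr ⟨G, 1, by simp⟩
  have hf0 : f ∈ E := by simpa using hmem (MvPolynomial.X 0)
  have hf1 : ratDeriv f ∈ E := by simpa using hmem (MvPolynomial.X 1)
  -- Differentiating F(f, f') = 0 gives F_x f' + F_y f'' = 0, and F_y(f, f') ≠ 0 since `F` does not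
  -- divide F_y.
  have hf2 : ratDeriv (ratDeriv f) ∈ E := by
    have h1 := derivation_aeval_pair (ratDerivation ℂ) f (ratDeriv f) F
    rw [hFf, map_zero] at h1
    simp only [ratDerivation_apply] at h1
    have h2 : MvPolynomial.aeval ![f, ratDeriv f] (MvPolynomial.pderiv 1 F) ≠ 0 := fun h =>
      not_dvd_pderiv_one hord (dvd_of_aeval_eq_zero hF hord htr hFf h)
    have h3 : ratDeriv (ratDeriv f) =
        -(MvPolynomial.aeval ![f, ratDeriv f] (MvPolynomial.pderiv 0 F) * ratDeriv f) /
          MvPolynomial.aeval ![f, ratDeriv f] (MvPolynomial.pderiv 1 F) := by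
      rw [eq_div_iff h2]
      linear_combination -h1
    rw [h3]
    exact div_mem (neg_mem (mul_mem (hmem _) hf1)) (hmem _)
  have hclosed := derivation_mem_adjoin (ratDerivation ℂ) (S := S) (by
    rintro _ ⟨i, rfl⟩
    fin_cases i
    · exact hf1
    · exact hf2)
  have hbot : E ≠ ⊥ := fun h => by
    rw [h, IntermediateField.mem_bot] at hf0
    obtain ⟨a, ha⟩ := hf0
    exact hconst ⟨a, by rw [← ha]; rfl⟩
  have hX : (RatFunc.X : RatFunc ℂ) ∈ E := mem_of_derivation_eq_one (ratDerivation ℂ)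
    (fun x hx => by
      obtain ⟨a, ha⟩ := ratDeriv_eq_zero_iff.mp hx
      exact ⟨a, by rw [ha]; rfl⟩) E hclosed ratDeriv_X
    (RatFunc.IntermediateField.isAlgebraic_X hbot)
  obtain ⟨A, B, hAB⟩ := (IntermediateField.mem_adjoin_range_iff ℂ _ _).mp hX
  -- Division by zero returns 0, so a vanishing denominator would give z = 0.
  refine ⟨A, B, fun h => ?_, hAB⟩
  rw [h, div_zero] at hAB
  exact RatFunc.X_ne_zero hAB

/-- A point `(x, y)` of the curve lies over the parameter `A(x, y) / B(x, y)`. -/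
theorem eq_div_of_inverse (hF : Irreducible F) (hord : 0 < F.degreeOf 1) {f g h : RatFunc ℂ}
    (hf : Transcendental ℂ f) (hFfg : MvPolynomial.aeval ![f, g] F = 0)
    {A B : MvPolynomial (Fin 2) ℂ}
    (hX : RatFunc.X = MvPolynomial.aeval ![f, g] A / MvPolynomial.aeval ![f, g] B)
    {L : Type} [Field L] [Algebra ℂ L] {x y : L} (hxy : MvPolynomial.aeval ![x, y] F = 0)
    (hB : MvPolynomial.aeval ![x, y] B ≠ 0) {H : MvPolynomial (Fin 2) ℂ}
    (hh : h = MvPolynomial.aeval ![f, g] H) {m : L}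
    (hm : m = MvPolynomial.aeval ![x, y] A / MvPolynomial.aeval ![x, y] B) :
    aeval m h.denom ≠ 0 ∧ MvPolynomial.aeval ![x, y] H = aeval m h.num / aeval m h.denom := by
  have hker (r : MvPolynomial (Fin 2) ℂ) (hr : MvPolynomial.aeval ![f, g] r = 0) :
      MvPolynomial.aeval ![x, y] r = 0 := by
    obtain ⟨c, rfl⟩ := dvd_of_aeval_eq_zero hF hord hf hFfg hr
    rw [map_mul, hxy, zero_mul]
  have hBfg : MvPolynomial.aeval ![f, g] B ≠ 0 := fun h0 => hB (hker B h0)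
  let P (p : ℂ[X]) : MvPolynomial (Fin 2) ℂ := aeval (MvPolynomial.X 0) p
  have hP {A : Type} [Field A] [Algebra ℂ A] (w : Fin 2 → A) (p : ℂ[X]) :
      MvPolynomial.aeval w (P p) = aeval (w 0) p := by
    simp only [P, ← Polynomial.aeval_algHom_apply, MvPolynomial.aeval_X]
  -- Write z = A / B and h = HB / B over the same denominator; the relation num(z) = h · denom(z)
  -- then carries over from (f, g) to (x, y).
  have hrel := aeval_eq_zero_of_specialization (MvPolynomial.aeval ![f, g])
    (MvPolynomial.aeval ![x, y]) hker (a := ![A, H * B]) (q := B) hB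
    (G := P h.num - MvPolynomial.X 1 * P h.denom) (by
      simp only [map_sub, map_mul, hP, MvPolynomial.aeval_X, Matrix.cons_val_zero,
        Matrix.cons_val_one, ← hX, ← hh, mul_div_cancel_right₀ _ hBfg]
      rw [RatFunc.aeval_X_left_eq_algebraMap, RatFunc.aeval_X_left_eq_algebraMap, sub_eq_zero,
        ← div_eq_iff (by simpa using h.denom_ne_zero), RatFunc.num_div_denom])
  simp only [map_sub, map_mul, hP, MvPolynomial.aeval_X, Matrix.cons_val_zero,
    Matrix.cons_val_one, mul_div_cancel_right₀ _ hB, ← hm] at hrel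
  have hden : aeval m h.denom ≠ 0 := by
    intro h0
    rw [h0, mul_zero, sub_zero] at hrel
    obtain ⟨u, v, huv⟩ := h.isCoprime_num_denom
    have := congrArg (aeval m) huv
    simp [h0, hrel] at this
  exact ⟨hden, by rw [eq_div_iff hden]; exact (sub_eq_zero.mp hrel).symm⟩

end Inverse

/-- A non-constant solution and its derivative parametrize the curve. -/
theorem isRationalParametrization_of_solution {F : MvPolynomial (Fin 2) ℂ} (hF : Irreducible F)
    (hord : 0 < F.degreeOf 1) {f : RatFunc ℂ} (hf : ratDeriv f ≠ 0)
    (hFf : MvPolynomial.aeval ![f, ratDeriv f] F = 0) :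
    IsRationalParametrization F f (ratDeriv f) := by
  obtain ⟨A, B, hB, hX⟩ := exists_inverse_of_solution hF hord hf hFf
  have htr : Transcendental ℂ f :=
    RatFunc.transcendental_of_ne_C f fun h => hf (ratDeriv_eq_zero_iff.mpr h)
  have hpair (t : ℂ) : (fun i => value (![f, ratDeriv f] i) t) =
      ![value f t, value (ratDeriv f) t] := by
    ext i; fin_cases i <;> rfl
  have hdef {t : ℂ} (h1 : DefinedAt f t) (h2 : DefinedAt (ratDeriv f) t) :
      ∀ i, DefinedAt (![f, ratDeriv f] i) t := fun i => by fin_cases i <;> assumption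
  constructor
  · refine ((finite_not_definedAt f).union (finite_not_definedAt (ratDeriv f))).subset ?_
    intro t ht
    by_contra hcon
    simp only [Set.mem_union, Set.mem_ofPred_eq, not_or, not_not] at hcon
    refine ht ⟨hcon.1, hcon.2, ?_⟩
    rw [← hpair]
    exact eval_value_eq_zero hFf (hdef hcon.1 hcon.2)
  · have hndvd : ¬ F ∣ B := by
      rintro ⟨c, rfl⟩
      exact hB (by rw [map_mul, hFf, zero_mul])
    -- Exceptional points of the curve can only be zeros of `B`; elsewhere the parameter must be
    -- A(x, y) / B(x, y).
    refine (finite_common_zeros hF hord hndvd).subset ?_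
    rintro ⟨x, y⟩ ⟨hxy, hnot⟩
    refine ⟨hxy, ?_⟩
    by_contra hBxy
    refine hnot ?_
    simp only at hxy hBxy ⊢
    rw [← MvPolynomial.aeval_eq_eval] at hxy hBxy
    obtain ⟨h1, h2⟩ := eq_div_of_inverse hF hord (h := f) htr hFf hX hxy hBxy
      (H := MvPolynomial.X 0) (by simp) rfl
    obtain ⟨h3, h4⟩ := eq_div_of_inverse hF hord (h := ratDeriv f) htr hFf hX hxy hBxy
      (H := MvPolynomial.X 1) (by simp) rfl
    simp only [coe_aeval_eq_eval, MvPolynomial.aeval_X, Matrix.cons_val_zero,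
      Matrix.cons_val_one] at h1 h2 h3 h4
    refine ⟨_, ⟨h1, h3, by rw [value_eq]; exact h2, by rw [value_eq]; exact h4⟩, ?_⟩
    rintro t ⟨ht1, ht2, rfl, rfl⟩
    rw [eq_div_iff hBxy]
    -- Adjoining z as a third coordinate turns z = A / B into a polynomial relation that can be
    -- evaluated at `t`.
    have hrel : MvPolynomial.aeval ![RatFunc.X, f, ratDeriv f] (MvPolynomial.X 0 *
        MvPolynomial.rename Fin.succ B - MvPolynomial.rename Fin.succ A) = 0 := by
      have hcomp : ![RatFunc.X, f, ratDeriv f] ∘ Fin.succ = ![f, ratDeriv f] := by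
        ext i; fin_cases i <;> rfl
      rw [map_sub, map_mul, MvPolynomial.aeval_rename, MvPolynomial.aeval_rename, hcomp,
        MvPolynomial.aeval_X, sub_eq_zero, ← eq_div_iff hB]
      exact hX
    have hval := eval_value_eq_zero hrel (t := t) (fun i => by
      fin_cases i
      · simp [DefinedAt]
      · exact ht1
      · exact ht2)
    have hcomp : (fun i => value (![RatFunc.X, f, ratDeriv f] i) t) ∘ Fin.succ =
        ![value f t, value (ratDeriv f) t] := by
      ext i; fin_cases i <;> rfl
    rw [map_sub, map_mul, MvPolynomial.eval_rename, MvPolynomial.eval_rename, hcomp,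
      MvPolynomial.eval_X, sub_eq_zero] at hval
    simpa [value, MvPolynomial.aeval_eq_eval] using hval

/-! ### General solutions and solutions in `ℂ(z)` -/

theorem transcendental_of_ratDeriv_ne_zero {k L : Type*} [Field k] [Field L] [CharZero L]
    [Algebra k L] {g : RatFunc L} (hg : ratDeriv g ≠ 0) : Transcendental k g := by
  have h : Transcendental L g :=
    RatFunc.transcendental_of_ne_C g fun h => hg (ratDeriv_eq_zero_iff.mpr h)
  exact fun hk => h (hk.extendScalars (algebraMap k L).injective)

theorem aeval_pair_algHom {k A B : Type*} [CommRing k] [CommRing A] [CommRing B] [Algebra k A]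
    [Algebra k B] (σ : A →ₐ[k] B) (x y : A) (F : MvPolynomial (Fin 2) k) :
    MvPolynomial.aeval ![σ x, σ y] F = σ (MvPolynomial.aeval ![x, y] F) := by
  have h : ![σ x, σ y] = σ ∘ ![x, y] := by ext i; fin_cases i <;> rfl
  rw [h]
  exact (MvPolynomial.comp_aeval_apply _ _ _).symm

/-- Specializing the parameter of a non-constant general solution. -/
theorem exists_solution_of_ratZL {F : MvPolynomial (Fin 2) ℂ} {w : RatZL}
    (hw : MvPolynomial.aeval ![w, ratDeriv w] F = 0) (hconst : ¬ IsConstantInZ w) :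
    ∃ f : RatFunc ℂ, ratDeriv f ≠ 0 ∧ MvPolynomial.aeval ![f, ratDeriv f] F = 0 := by
  have hw' : ratDeriv w ≠ 0 := fun h => hconst (ratDeriv_eq_zero_iff.mp h)
  let j : ℂ[X][X] →ₐ[ℂ] (RatFunc ℂ)[X] := mapAlgHom (IsScalarTower.toAlgHom ℂ ℂ[X] (RatFunc ℂ))
  have hj (p : ℂ[X][X]) : j p = p.map (algebraMap ℂ[X] (RatFunc ℂ)) := rfl
  have hjinj : Function.Injective j := map_injective _ (RatFunc.algebraMap_injective ℂ)
  let ι : ℂ[X][X] →ₐ[ℂ] RatZL := (IsScalarTower.toAlgHom ℂ (RatFunc ℂ)[X] RatZL).comp j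
  have hι (p : ℂ[X][X]) : ι p = algebraMap (RatFunc ℂ)[X] RatZL (j p) := rfl
  have hιinj : Function.Injective ι := (RatFunc.algebraMap_injective _).comp hjinj
  -- Write `w` as a quotient over ℂ[λ][z], where λ can be given a numerical value.
  obtain ⟨P, Q, hQ, hwPQ⟩ : ∃ P Q : ℂ[X][X], Q ≠ 0 ∧ w = ι P / ι Q := by
    obtain ⟨b, hb, hb'⟩ := IsLocalization.integerNormalization_spec (nonZeroDivisors ℂ[X]) w.num
    obtain ⟨c, hc, hc'⟩ := IsLocalization.integerNormalization_spec (nonZeroDivisors ℂ[X]) w.denom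
    set P := IsLocalization.integerNormalization (nonZeroDivisors ℂ[X]) w.num
    set Q := IsLocalization.integerNormalization (nonZeroDivisors ℂ[X]) w.denom
    have hb0 : (C (algebraMap ℂ[X] (RatFunc ℂ) b)) ≠ 0 := by simpa using nonZeroDivisors.ne_zero hb
    have hc0 : (C (algebraMap ℂ[X] (RatFunc ℂ) c)) ≠ 0 := by simpa using nonZeroDivisors.ne_zero hc
    have e1 : j (C c * P) = (C (algebraMap ℂ[X] (RatFunc ℂ) c) *
        C (algebraMap ℂ[X] (RatFunc ℂ) b)) * w.num := by
      rw [map_mul, hj P, hb', Algebra.smul_def, hj, map_C, mul_assoc]; rfl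
    have e2 : j (C b * Q) = (C (algebraMap ℂ[X] (RatFunc ℂ) c) *
        C (algebraMap ℂ[X] (RatFunc ℂ) b)) * w.denom := by
      rw [map_mul, hj Q, hc', Algebra.smul_def, hj, map_C, mul_comm (C _) (C _), mul_assoc]; rfl
    refine ⟨C c * P, C b * Q, fun h0 => ?_, ?_⟩
    · rw [h0, map_zero] at e2
      exact mul_ne_zero (mul_ne_zero hc0 hb0) w.denom_ne_zero e2.symm
    · rw [hι, hι, e1, e2, map_mul, map_mul _ _ w.denom]
      exact (w.num_div_denom.symm).trans
        (mul_div_mul_left _ _ (RatFunc.algebraMap_ne_zero (mul_ne_zero hc0 hb0))).symm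
  set W : ℂ[X][X] := derivative P * Q - P * derivative Q with hW
  have hw'W : ratDeriv w = ι W / ι (Q ^ 2) := by
    rw [hwPQ, hι, hι, ratDeriv_div _ _ ((map_ne_zero_iff j hjinj).mpr hQ), hι, hι]
    simp only [hW, map_sub, map_mul, map_pow, hj, derivative_map,
      Polynomial.map_sub, Polynomial.map_mul, Polynomial.map_pow]
  have hW0 : W ≠ 0 := by
    rintro h
    rw [hw'W, h, map_zero] at hw'
    exact hw' (zero_div _)
  -- At this value of λ both `Q` and `W` stay non-zero: the quotient keeps its meaning and remains
  -- non-constant in z.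
  obtain ⟨l, hl⟩ : ∃ l : ℂ, (Q * W).leadingCoeff.eval l ≠ 0 := by
    by_contra! hcon
    exact leadingCoeff_ne_zero.mpr (mul_ne_zero hQ hW0)
      (Polynomial.funext fun l => by rw [hcon l, eval_zero])
  let j' : ℂ[X][X] →ₐ[ℂ] ℂ[X] := mapAlgHom (aeval l)
  have hj' (p : ℂ[X][X]) : j' p = p.map (aeval l : ℂ[X] →ₐ[ℂ] ℂ).toRingHom := rfl
  let σ : ℂ[X][X] →ₐ[ℂ] RatFunc ℂ := (IsScalarTower.toAlgHom ℂ ℂ[X] (RatFunc ℂ)).comp j'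
  have hσ (p : ℂ[X][X]) : σ p = algebraMap ℂ[X] (RatFunc ℂ) (j' p) := rfl
  have hQW : j' Q * j' W ≠ 0 := by
    rw [← map_mul]
    intro h
    have h1 := congrArg (fun p => coeff p (Q * W).natDegree) h
    rw [hj'] at h1
    simp only [coeff_map, coeff_zero, coeff_natDegree] at h1
    exact hl (by simpa using h1)
  have hσQ : σ Q ≠ 0 := RatFunc.algebraMap_ne_zero (left_ne_zero_of_mul hQW)
  have hσW : σ W ≠ 0 := RatFunc.algebraMap_ne_zero (right_ne_zero_of_mul hQW)
  have hd : ratDeriv (σ P / σ Q) = σ W / σ (Q ^ 2) := by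
    rw [hσ, hσ, ratDeriv_div _ _ (left_ne_zero_of_mul hQW), hσ, hσ]
    simp only [hW, map_sub, map_mul, map_pow, hj', derivative_map,
      Polynomial.map_sub, Polynomial.map_mul, Polynomial.map_pow]
  refine ⟨σ P / σ Q, ?_, ?_⟩
  · rw [hd]
    exact div_ne_zero hσW (by rw [map_pow]; exact pow_ne_zero _ hσQ)
  · have hpair {L : Type} [Field L] [Algebra ℂ L] (τ : ℂ[X][X] →ₐ[ℂ] L) (hτ : τ Q ≠ 0) :
        (fun i => τ ((![P * Q, W] : Fin 2 → ℂ[X][X]) i) / τ (Q ^ 2)) =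
          ![τ P / τ Q, τ W / τ (Q ^ 2)] := by
      ext i
      fin_cases i
      · simp only [Fin.zero_eta, Matrix.cons_val_zero, map_mul, map_pow]
        field_simp
      · rfl
    have h := aeval_eq_zero_of_specialization ι σ
      (fun r hr => by rw [(map_eq_zero_iff ι hιinj).mp hr, map_zero])
      (a := ![P * Q, W]) (q := Q ^ 2) (G := F) (by rw [map_pow]; exact pow_ne_zero _ hσQ)
      (by rw [hpair ι ((map_ne_zero_iff ι hιinj).mpr hQ), ← hwPQ, ← hw'W]; exact hw)
    rwa [hpair σ hσQ, ← hd] at h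

theorem ratDeriv_zVar_add_lamVar : ratDeriv (zVar + lamVar) = 1 := by
  rw [ratDeriv_add, zVar, lamVar, ratDeriv_X, ratDeriv_C, add_zero]

theorem transcendental_zVar_add_lamVar : Transcendental ℂ (zVar + lamVar) :=
  transcendental_of_ratDeriv_ne_zero (by rw [ratDeriv_zVar_add_lamVar]; exact one_ne_zero)

/-- The parameter really occurs in `f(z + λ)`. -/
theorem subst_zVar_add_lamVar_ne_ofZ {f : RatFunc ℂ} (hf : ¬ ∃ a, f = RatFunc.C a)
    (v : RatFunc ℂ) : subst (zVar + lamVar) transcendental_zVar_add_lamVar f ≠ ofZ v := by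
  intro h
  have hz (p : ℂ[X]) : p.eval₂ (RatFunc.C.comp RatFunc.C : ℂ →+* RatZL) zVar =
      algebraMap (RatFunc ℂ)[X] RatZL (p.map RatFunc.C) := by
    rw [← RatFunc.aeval_X_left_eq_algebraMap, aeval_def, eval₂_map]
    rfl
  have hg (p : ℂ[X]) : aeval (zVar + lamVar) p =
      algebraMap (RatFunc ℂ)[X] RatZL ((p.map RatFunc.C).comp (X + C RatFunc.X)) := by
    have e : zVar + lamVar = algebraMap (RatFunc ℂ)[X] RatZL (X + C RatFunc.X) := by
      simp [zVar, lamVar]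
    rw [e, aeval_algebraMap_apply, comp, eval₂_map, aeval_def]
    rfl
  have hinj := RatFunc.algebraMap_injective (RatFunc ℂ)
  have hvd : v.denom.map (RatFunc.C : ℂ →+* RatFunc ℂ) ≠ 0 :=
    (Polynomial.map_ne_zero_iff RatFunc.C_injective).mpr v.denom_ne_zero
  have hfd := aeval_ne_zero_of_transcendental transcendental_zVar_add_lamVar f.denom_ne_zero
  rw [subst_apply, ofZ, RatFunc.eval, hz, hz] at h
  replace h := (div_eq_div_iff (G₀ := RatZL) hfd (RatFunc.algebraMap_ne_zero hvd)).mp h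
  rw [hg, hg, ← map_mul, ← map_mul] at h
  have h1 := hinj h
  -- Setting z = c in f(z + λ) = v(z) gives f(c + λ) = v(c), free of λ, so `f` would be constant.
  obtain ⟨c, hc⟩ : ∃ c : ℂ, v.denom.eval c ≠ 0 := by
    by_contra! hcon
    exact v.denom_ne_zero (Polynomial.funext fun l => by rw [hcon l, eval_zero])
  have h2 := congrArg (eval (RatFunc.C c)) h1
  have htr : Transcendental ℂ (RatFunc.C c + RatFunc.X : RatFunc ℂ) :=
    transcendental_of_ratDeriv_ne_zero (by
      rw [ratDeriv_add, ratDeriv_C, ratDeriv_X, zero_add]; exact one_ne_zero)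
  have hev (p : ℂ[X]) : eval (RatFunc.C c) ((p.map RatFunc.C).comp (X + C RatFunc.X)) =
      aeval (RatFunc.C c + RatFunc.X : RatFunc ℂ) p := by
    rw [eval_comp, eval_map, aeval_def]
    simp
  rw [eval_mul, eval_mul, hev, hev, eval_map, eval_map, eval₂_at_apply, eval₂_at_apply] at h2
  have h3 : C (v.denom.eval c) * f.num - C (v.num.eval c) * f.denom = 0 := by
    by_contra hne
    refine aeval_ne_zero_of_transcendental htr hne ?_
    rw [map_sub, map_mul, map_mul, aeval_C, aeval_C, sub_eq_zero, mul_comm]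
    exact h2
  refine hf ⟨v.num.eval c / v.denom.eval c, ?_⟩
  have h4 : f.num * C (v.denom.eval c) = C (v.num.eval c) * f.denom := by
    linear_combination h3
  have h5 := (RatFunc.num_mul_eq_mul_denom_iff (by simpa using hc)).mp h4
  rw [h5, RatFunc.algebraMap_C, RatFunc.algebraMap_C, map_div₀]

theorem isRationalGeneralSolution_subst {F : MvPolynomial (Fin 2) ℂ} {f : RatFunc ℂ}
    (hf : ratDeriv f ≠ 0) (hFf : MvPolynomial.aeval ![f, ratDeriv f] F = 0) :
    IsRationalGeneralSolution F (subst (zVar + lamVar) transcendental_zVar_add_lamVar f) where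
  solves := by
    rw [ratDeriv_subst, ratDeriv_zVar_add_lamVar, mul_one, aeval_pair_algHom, hFf, map_zero]
  depends := subst_zVar_add_lamVar_ne_ofZ fun h => hf (ratDeriv_eq_zero_iff.mpr h)

theorem hasNonconstantRationalGeneralSolution_iff {F : MvPolynomial (Fin 2) ℂ} :
    HasNonconstantRationalGeneralSolution F ↔
      ∃ f : RatFunc ℂ, ratDeriv f ≠ 0 ∧ MvPolynomial.aeval ![f, ratDeriv f] F = 0 := by
  refine ⟨fun ⟨w, hw, hc⟩ => exists_solution_of_ratZL hw.solves hc, fun ⟨f, hf, hFf⟩ =>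
    ⟨_, isRationalGeneralSolution_subst hf hFf, fun ⟨a, ha⟩ => ?_⟩⟩
  have h := ratDeriv_C a
  rw [← ha, ratDeriv_subst, ratDeriv_zVar_add_lamVar, mul_one, map_eq_zero] at h
  exact hf h

theorem isRationalGeneralSolution_riccati :
    IsRationalGeneralSolution (MvPolynomial.X 1 + MvPolynomial.X 0 ^ 2)
      (1 / (zVar + lamVar)) := by
  have hX : (RatFunc.X : RatFunc ℂ) ≠ 0 := RatFunc.X_ne_zero
  have hd : ratDeriv (1 / RatFunc.X : RatFunc ℂ) = -1 / RatFunc.X ^ 2 := by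
    have := ratDeriv_div (1 : ℂ[X]) X X_ne_zero
    simpa using this
  have h := isRationalGeneralSolution_subst (F := MvPolynomial.X 1 + MvPolynomial.X 0 ^ 2)
    (f := 1 / RatFunc.X) (by rw [hd]; exact div_ne_zero (by simp) (pow_ne_zero _ hX)) (by
      simp only [map_add, map_pow, MvPolynomial.aeval_X, Matrix.cons_val_zero,
        Matrix.cons_val_one, hd]
      field_simp
      ring)
  rwa [map_div₀, map_one, subst_X] at h

/-! ### From a reduction to a solution -/

/-- For transcendental `g` no denominator can vanish, so composition is a field homomorphism. -/
theorem ratComp_eq_subst {g : RatFunc ℂ} (hg : Transcendental ℂ g) (f : RatFunc ℂ) :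
    ratComp f g = subst g hg f := by
  rw [subst_apply, aeval_def, aeval_def]
  rfl

/-- If `h` solves u' = S(u), then φ(αh + β) solves the original equation. -/
theorem exists_solution_of_affinelyReduces {F : MvPolynomial (Fin 2) ℂ} {φ ψ S h : RatFunc ℂ}
    (hF : MvPolynomial.aeval ![φ, ψ] F = 0) (hS : S ≠ 0)
    (hred : AffinelyReduces (reducedRHS φ ψ) S) (hh : Transcendental ℂ h)
    (hSh : ratDeriv h = subst h hh S) :
    ∃ f : RatFunc ℂ, ratDeriv f ≠ 0 ∧ MvPolynomial.aeval ![f, ratDeriv f] F = 0 := by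
  obtain ⟨α, β, hα, hred⟩ := hred
  set g : RatFunc ℂ := RatFunc.C α * RatFunc.X + RatFunc.C β with hg
  have hα' : (RatFunc.C α : RatFunc ℂ) ≠ 0 := by simpa using hα
  have hg' : ratDeriv g = RatFunc.C α := by
    rw [hg, ratDeriv_add, ratDeriv_mul, ratDeriv_C, ratDeriv_C, ratDeriv_X]
    ring
  have hgt : Transcendental ℂ g := transcendental_of_ratDeriv_ne_zero (by rwa [hg'])
  rw [ratComp_eq_subst hgt, reducedRHS, map_div₀, div_div, ← hg', ← ratDeriv_subst] at hred
  set φ₁ := subst g hgt φ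
  set ψ₁ := subst g hgt ψ
  -- By the convention x / 0 = 0, a vanishing derivative would force S = 0.
  have hne : ratDeriv φ₁ ≠ 0 := fun h0 => hS (by rw [← hred, h0, div_zero])
  have hψ : ψ₁ = S * ratDeriv φ₁ := by rw [← hred, div_mul_cancel₀ _ hne]
  have hd : ratDeriv (subst h hh φ₁) = subst h hh ψ₁ := by
    rw [ratDeriv_subst, hψ, map_mul, hSh, mul_comm]
  refine ⟨subst h hh φ₁, ?_, ?_⟩
  · rw [hd, hψ]
    exact (_root_.map_ne_zero _).mpr (mul_ne_zero hS hne)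
  · rw [hd, aeval_pair_algHom, aeval_pair_algHom, hF, map_zero, map_zero]

theorem ratDeriv_inv_X : ratDeriv (RatFunc.X⁻¹ : RatFunc ℂ) = -(RatFunc.X⁻¹) ^ 2 := by
  have h : ratDeriv (RatFunc.X⁻¹ : RatFunc ℂ) = _ := (ratDerivation ℂ).leibniz_inv RatFunc.X
  rw [h, ratDerivation_apply, ratDeriv_X, smul_eq_mul, mul_one]

theorem exists_solution_of_reduces {F : MvPolynomial (Fin 2) ℂ} {φ ψ : RatFunc ℂ}
    (hF : MvPolynomial.aeval ![φ, ψ] F = 0)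
    (hred : ReducesToLinear φ ψ ∨ ReducesToRiccati φ ψ) :
    ∃ f : RatFunc ℂ, ratDeriv f ≠ 0 ∧ MvPolynomial.aeval ![f, ratDeriv f] F = 0 := by
  have hX : (RatFunc.X : RatFunc ℂ) ≠ 0 := RatFunc.X_ne_zero
  rcases hred with ⟨c, hc, hred⟩ | hred
  · have hc' : (RatFunc.C c : RatFunc ℂ) ≠ 0 := by simpa using hc
    have hd : ratDeriv (RatFunc.C c * RatFunc.X) = RatFunc.C c := by
      rw [ratDeriv_mul, ratDeriv_C, ratDeriv_X]
      ring
    refine exists_solution_of_affinelyReduces hF hc' hred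
      (transcendental_of_ratDeriv_ne_zero (by rwa [hd])) ?_
    rw [subst_C]
    exact hd
  · refine exists_solution_of_affinelyReduces hF (neg_ne_zero.mpr (pow_ne_zero 2 hX)) hred
      (transcendental_of_ratDeriv_ne_zero (by
        rw [ratDeriv_inv_X]
        exact neg_ne_zero.mpr (pow_ne_zero 2 (inv_ne_zero hX)))) ?_
    rw [map_neg, map_pow, subst_X]
    exact ratDeriv_inv_X

/-! ### Injective rational functions -/

/-- For generic c the polynomial P - cQ has degree at least those of `P` and `Q`, and only simple
roots, all lying in `T` with value c; injectivity allows at most one. -/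
theorem natDegree_le_one_of_injOn {m : RatFunc ℂ} (hm : ratDeriv m ≠ 0) {T : Set ℂ}
    (hT : Tᶜ.Finite) (hinj : Set.InjOn (value m) T) :
    m.num.natDegree ≤ 1 ∧ m.denom.natDegree ≤ 1 := by
  classical
  set P := m.num
  set Q := m.denom
  set W := derivative P * Q - P * derivative Q with hW
  have hQ : Q ≠ 0 := m.denom_ne_zero
  have hP : P ≠ 0 := fun h => hm (by
    rw [RatFunc.num_eq_zero_iff.mp h]
    simpa using ratDeriv_C (0 : ℂ))
  have hW0 : W ≠ 0 := by
    intro h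
    refine hm ?_
    change algebraMap ℂ[X] (RatFunc ℂ) W / _ = 0
    rw [h, map_zero, zero_div]
  -- Avoided are the values of `m` outside `T` and at zeros of `W`, and two ratios at which the top
  -- coefficient of `P` or of `Q` could cancel.
  obtain ⟨c, hc⟩ := (((hT.union W.roots.toFinset.finite_toSet).image (value m)).union
    (Set.toFinite {P.coeff P.natDegree / Q.coeff P.natDegree,
      P.coeff Q.natDegree / Q.coeff Q.natDegree})).infinite_compl.nonempty
  simp only [Set.mem_compl_iff, Set.mem_union, Set.mem_insert_iff, Set.mem_singleton_iff,
    not_or] at hc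
  obtain ⟨hcimg, hcP, hcQ⟩ := hc
  set D := P - C c * Q with hD
  have hPD : P.natDegree ≤ D.natDegree := by
    refine le_natDegree_of_ne_zero fun h => ?_
    rw [hD, coeff_sub, coeff_C_mul, sub_eq_zero] at h
    by_cases h0 : Q.coeff P.natDegree = 0
    · rw [h0, mul_zero, coeff_natDegree, leadingCoeff_eq_zero] at h
      exact hP h
    · exact hcP (by rw [h, mul_div_cancel_right₀ _ h0])
  have hQD : Q.natDegree ≤ D.natDegree := by
    refine le_natDegree_of_ne_zero fun h => ?_
    rw [hD, coeff_sub, coeff_C_mul, sub_eq_zero] at h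
    have h0 : Q.coeff Q.natDegree ≠ 0 := by
      rw [coeff_natDegree]
      exact leadingCoeff_ne_zero.mpr hQ
    exact hcQ (by rw [h, mul_div_cancel_right₀ _ h0])
  by_cases hD0 : D = 0
  · rw [hD0, natDegree_zero] at hPD hQD
    omega
  have hroot (t : ℂ) (ht : D.IsRoot t) :
      P.eval t = c * Q.eval t ∧ t ∈ T ∧ value m t = c ∧ W.eval t ≠ 0 := by
    have h1 : P.eval t = c * Q.eval t := by
      simpa [hD, IsRoot.def, sub_eq_zero] using ht
    have h2 : Q.eval t ≠ 0 := by
      intro h0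
      obtain ⟨u, v, huv⟩ := m.isCoprime_num_denom
      have := congrArg (eval t) huv
      rw [eval_add, eval_mul, eval_mul, eval_one, h0, h1, h0] at this
      simp at this
    have h3 : value m t = c := by rw [value_eq, h1, mul_div_cancel_right₀ _ h2]
    have h4 : t ∉ Tᶜ ∪ (W.roots.toFinset : Set ℂ) := fun h => hcimg ⟨t, h, h3⟩
    simp only [Set.mem_union, Set.mem_compl_iff, not_or, not_not] at h4
    exact ⟨h1, h4.1, h3, fun h => h4.2 (by simpa [hW0] using h)⟩
  have hnodup : D.roots.Nodup := by
    rw [Multiset.nodup_iff_count_le_one]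
    intro t
    rw [count_roots]
    by_contra hlt
    rw [not_le, one_lt_rootMultiplicity_iff_isRoot hD0] at hlt
    obtain ⟨h1, -, -, h4⟩ := hroot t hlt.1
    have h5 : (derivative P).eval t = c * (derivative Q).eval t := by
      simpa [hD, IsRoot.def, sub_eq_zero] using hlt.2
    -- A double root would satisfy P = cQ and P' = cQ', making `W` vanish there.
    exact h4 (by rw [hW, eval_sub, eval_mul, eval_mul, h1, h5]; ring)
  have hcard : D.natDegree ≤ 1 := by
    rw [← IsAlgClosed.card_roots_eq_natDegree, ← Multiset.toFinset_card_of_nodup hnodup,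
      Finset.card_le_one]
    intro s hs t ht
    rw [Multiset.mem_toFinset, mem_roots hD0] at hs ht
    obtain ⟨-, hs1, hs2, -⟩ := hroot s hs
    obtain ⟨-, ht1, ht2, -⟩ := hroot t ht
    exact hinj hs1 ht1 (hs2.trans ht2.symm)
  exact ⟨hPD.trans hcard, hQD.trans hcard⟩

/-! ### From a solution to a reduction -/

theorem ratComp_algebraMap (p : ℂ[X]) (g : RatFunc ℂ) :
    ratComp (algebraMap ℂ[X] (RatFunc ℂ) p) g = aeval g p := by
  simp [ratComp, aeval_def]

theorem reduces_of_natDegree_le_one {φ ψ m : RatFunc ℂ} (hm : ratDeriv m ≠ 0)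
    (hR : reducedRHS φ ψ = (ratDeriv m)⁻¹) (hnum : m.num.natDegree ≤ 1)
    (hden : m.denom.natDegree ≤ 1) : ReducesToLinear φ ψ ∨ ReducesToRiccati φ ψ := by
  obtain ⟨a, b, hP⟩ := exists_eq_X_add_C_of_natDegree_le_one hnum
  obtain ⟨c, d, hQ⟩ := exists_eq_X_add_C_of_natDegree_le_one hden
  set w := a * d - b * c with hw
  have hW : derivative m.num * m.denom - m.num * derivative m.denom = C w := by
    rw [hP, hQ, hw]
    simp only [derivative_add, derivative_mul, derivative_C, derivative_X, map_sub, map_mul]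
    ring
  have hm' : ratDeriv m = RatFunc.C w / algebraMap ℂ[X] (RatFunc ℂ) ((C c * X + C d) ^ 2) := by
    rw [ratDeriv, hW, ← hQ, RatFunc.algebraMap_C]
  have hw0 : w ≠ 0 := by
    intro h
    rw [hm', h, map_zero, zero_div] at hm
    exact hm rfl
  have hR' : reducedRHS φ ψ = algebraMap ℂ[X] (RatFunc ℂ) (C w⁻¹ * (C c * X + C d) ^ 2) := by
    rw [hR, hm', inv_div, map_mul, RatFunc.algebraMap_C, map_inv₀, div_eq_inv_mul]
  by_cases hc : c = 0
  · have hd : d ≠ 0 := by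
      rintro rfl
      exact m.denom_ne_zero (by rw [hQ, hc]; simp)
    refine Or.inl ⟨w⁻¹ * d ^ 2, mul_ne_zero (inv_ne_zero hw0) (pow_ne_zero _ hd), 1, 0,
      one_ne_zero, ?_⟩
    rw [hR', ratComp_algebraMap, hc]
    simp
  -- The shift moves the double zero -d/c of R to 0, and the scaling normalizes the coefficient of
  -- u² to -1.
  · refine Or.inr ⟨-w / c ^ 2, -d / c, div_ne_zero (neg_ne_zero.mpr hw0) (pow_ne_zero _ hc), ?_⟩
    have hc' : (RatFunc.C c : RatFunc ℂ) ≠ 0 := by simpa using hc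
    have hw' : (RatFunc.C w : RatFunc ℂ) ≠ 0 := by simpa using hw0
    rw [hR', ratComp_algebraMap]
    simp only [map_mul, map_pow, map_add, aeval_C, aeval_X, RatFunc.algebraMap_eq_C, map_inv₀,
      map_div₀, map_neg]
    field_simp
    ring

theorem aeval_eq_zero_of_isRationalParametrization {F : MvPolynomial (Fin 2) ℂ} {φ ψ : RatFunc ℂ}
    (h : IsRationalParametrization F φ ψ) : MvPolynomial.aeval ![φ, ψ] F = 0 := by
  refine aeval_eq_zero_of_infinite (h.on_curve.infinite_compl.mono fun t ht => ?_)
  rw [Set.mem_compl_iff, Set.mem_ofPred_eq, not_not] at ht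
  obtain ⟨h1, h2, h3⟩ := ht
  have hpair : (fun i => value (![φ, ψ] i) t) = ![value φ t, value ψ t] := by
    ext i; fin_cases i <;> rfl
  exact ⟨fun i => by fin_cases i <;> assumption, by rw [hpair]; exact h3⟩

/-- The curve has a point over all but finitely many x, whereas a constant φ would reach only one
abscissa. -/
theorem not_const_of_isRationalParametrization {F : MvPolynomial (Fin 2) ℂ}
    (hord : 0 < F.degreeOf 1) {φ ψ : RatFunc ℂ} (h : IsRationalParametrization F φ ψ) :
    ¬ ∃ a, φ = RatFunc.C a := by
  classical
  rintro ⟨a, rfl⟩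
  set f := (Bivariate.equivMvPolynomial ℂ).symm F with hf
  have hdeg : 0 < f.natDegree := natDegree_symm_pos hord
  have hlc : f.leadingCoeff ≠ 0 := leadingCoeff_ne_zero.mpr fun h0 => by simp [h0] at hdeg
  have hinf : ((f.leadingCoeff.roots.toFinset : Set ℂ) ∪ {a})ᶜ.Infinite :=
    (f.leadingCoeff.roots.toFinset.finite_toSet.union (Set.finite_singleton a)).infinite_compl
  refine hinf ((h.unique_param.image Prod.fst).subset fun x hx => ?_)
  simp only [Set.mem_compl_iff, Set.mem_union, Set.mem_singleton_iff, not_or] at hx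
  have hx1 : evalRingHom x f.leadingCoeff ≠ 0 := fun h0 => hx.1 (by simpa [hlc] using h0)
  obtain ⟨y, hy⟩ := IsAlgClosed.exists_root (f.map (evalRingHom x)) (by
    rw [degree_map_eq_of_leadingCoeff_ne_zero _ hx1]
    exact (natDegree_pos_iff_degree_pos.mp hdeg).ne')
  refine ⟨(x, y), ⟨?_, ?_⟩, rfl⟩
  · rw [eval_pair_eq_evalEval, ← hf, ← map_evalRingHom_eval]
    exact hy
  · rintro ⟨t, ⟨-, -, h1, -⟩, -⟩
    exact hx.2 (by simpa [value] using h1)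

/-- Being defined at `t` for both `m` and φ already prevents `f` from having a pole at m(t), by
coprimality of its numerator and denominator. -/
theorem value_subst {m f φ : RatFunc ℂ} (hm : Transcendental ℂ m) (hφ : φ = subst m hm f) {t : ℂ}
    (hmt : DefinedAt m t) (hφt : DefinedAt φ t) : value φ t = value f (value m t) := by
  let P (p : ℂ[X]) : MvPolynomial (Fin 2) ℂ := aeval (MvPolynomial.X 0) p
  have hP {A : Type} [Field A] [Algebra ℂ A] (w : Fin 2 → A) (p : ℂ[X]) :
      MvPolynomial.aeval w (P p) = aeval (w 0) p := by
    simp only [P, ← Polynomial.aeval_algHom_apply, MvPolynomial.aeval_X]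
  have hrel : MvPolynomial.aeval ![m, φ] (P f.num - MvPolynomial.X 1 * P f.denom) = 0 := by
    rw [map_sub, map_mul, hP, hP, MvPolynomial.aeval_X, sub_eq_zero]
    simp only [Matrix.cons_val_zero, Matrix.cons_val_one]
    rw [hφ, subst_apply,
      div_mul_cancel₀ _ (aeval_ne_zero_of_transcendental hm f.denom_ne_zero)]
  have hval := eval_value_eq_zero hrel (t := t) (fun i => by fin_cases i <;> assumption)
  rw [← MvPolynomial.aeval_eq_eval, map_sub, map_mul, hP, hP, MvPolynomial.aeval_X,
    sub_eq_zero] at hval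
  simp only [Matrix.cons_val_zero, Matrix.cons_val_one, coe_aeval_eq_eval] at hval
  have hden : f.denom.eval (value m t) ≠ 0 := by
    intro h0
    obtain ⟨u, v, huv⟩ := f.isCoprime_num_denom
    have := congrArg (eval (value m t)) huv
    rw [eval_add, eval_mul, eval_mul, eval_one, h0, hval, h0] at this
    simp at this
  rw [value_eq f, eq_div_iff hden, hval]

/-- The inverse of (f, f'), applied to (φ, ψ), is a reparametrization m with φ = f ∘ m and ψ = f' ∘
m; hence φ' = ψ m' and R = 1 / m'. -/
theorem reduces_of_solution {F : MvPolynomial (Fin 2) ℂ} (hF : Irreducible F)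
    (hord : 0 < F.degreeOf 1) {φ ψ f : RatFunc ℂ} (h : IsRationalParametrization F φ ψ)
    (hf : ratDeriv f ≠ 0) (hFf : MvPolynomial.aeval ![f, ratDeriv f] F = 0) :
    ReducesToLinear φ ψ ∨ ReducesToRiccati φ ψ := by
  obtain ⟨A, B, hB, hX⟩ := exists_inverse_of_solution hF hord hf hFf
  have htr : Transcendental ℂ f := transcendental_of_ratDeriv_ne_zero hf
  have hFφ := aeval_eq_zero_of_isRationalParametrization h
  have hφ := not_const_of_isRationalParametrization hord h
  have hBφ : MvPolynomial.aeval ![φ, ψ] B ≠ 0 := by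
    intro h0
    obtain ⟨c, rfl⟩ :=
      dvd_of_aeval_eq_zero hF hord (RatFunc.transcendental_of_ne_C φ hφ) hFφ h0
    exact hB (by rw [map_mul, hFf, zero_mul])
  set m : RatFunc ℂ := MvPolynomial.aeval ![φ, ψ] A / MvPolynomial.aeval ![φ, ψ] B with hm
  have h1 := (eq_div_of_inverse hF hord (h := f) htr hFf hX hFφ hBφ
    (H := MvPolynomial.X 0) (by simp) hm).2
  have h2 := (eq_div_of_inverse hF hord (h := ratDeriv f) htr hFf hX hFφ hBφ
    (H := MvPolynomial.X 1) (by simp) hm).2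
  simp only [MvPolynomial.aeval_X, Matrix.cons_val_zero, Matrix.cons_val_one] at h1 h2
  have hmconst : ¬ ∃ a, m = RatFunc.C a := by
    rintro ⟨a, ha⟩
    have hC (p : ℂ[X]) : aeval (RatFunc.C a : RatFunc ℂ) p = RatFunc.C (p.eval a) := by
      rw [← RatFunc.algebraMap_eq_C, aeval_algebraMap_apply, coe_aeval_eq_eval]
    exact hφ ⟨_, by rw [h1, ha, hC, hC, ← map_div₀]⟩
  have hmt := RatFunc.transcendental_of_ne_C m hmconst
  have hm' : ratDeriv m ≠ 0 := fun h0 => hmconst (ratDeriv_eq_zero_iff.mp h0)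
  rw [← subst_apply hmt] at h1 h2
  have hψ : ψ ≠ 0 := by rw [h2]; exact (_root_.map_ne_zero _).mpr hf
  have hR : reducedRHS φ ψ = (ratDeriv m)⁻¹ := by
    rw [reducedRHS, show ratDeriv φ = ψ * ratDeriv m by rw [h1, ratDeriv_subst, ← h2]]
    field_simp
  set T : Set ℂ := {t | DefinedAt m t ∧ DefinedAt φ t ∧ DefinedAt ψ t ∧
    ∃! s : ℂ, DefinedAt φ s ∧ DefinedAt ψ s ∧ value φ t = value φ s ∧ value ψ t = value ψ s}
    with hT
  -- A bad point of the curve removes only finitely many parameters, since φ is not constant.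
  have hTfin : Tᶜ.Finite := by
    refine ((finite_not_definedAt m).union (h.on_curve.union
      (h.unique_param.biUnion fun p _ => finite_value_eq hφ p.1))).subset fun t ht => ?_
    by_contra hcon
    simp only [Set.mem_union, not_or, Set.mem_ofPred_eq, not_not, Set.mem_iUnion] at hcon
    obtain ⟨hm, ⟨h3, h4, h5⟩, h6⟩ := hcon
    refine ht ⟨hm, h3, h4, ?_⟩
    by_contra hex
    exact h6 ⟨(value φ t, value ψ t), ⟨h5, hex⟩, h3, rfl⟩
  -- Equal values of `m` give the same point of the curve, whose parameter is unique on `T`.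
  have hinj : Set.InjOn (value m) T := by
    rintro s ⟨hs1, hs2, hs3, hs⟩ t ⟨ht1, ht2, ht3, -⟩ hst
    refine hs.unique ⟨hs2, hs3, rfl, rfl⟩ ⟨ht2, ht3, ?_, ?_⟩
    · rw [value_subst hmt h1 hs1 hs2, value_subst hmt h1 ht1 ht2, hst]
    · rw [value_subst hmt h2 hs1 hs3, value_subst hmt h2 ht1 ht3, hst]
  obtain ⟨hn, hd⟩ := natDegree_le_one_of_injOn hm' hTfin hinj
  exact reduces_of_natDegree_le_one hm' hR hn hd

theorem reducesToLinear_ratDeriv {f : RatFunc ℂ} (hf : ratDeriv f ≠ 0) :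
    ReducesToLinear f (ratDeriv f) := by
  refine ⟨1, one_ne_zero, 1, 0, one_ne_zero, ?_⟩
  rw [reducedRHS, div_self hf]
  simp [ratComp]

end FirstOrderADE

end

theorem mainTheorem3 (F : MvPolynomial (Fin 2) ℂ) (hF : Irreducible F)
    (hord : 0 < F.degreeOf 1) :
    -- reduction along some rational parametrization
    (FirstOrderADE.HasNonconstantRationalGeneralSolution F ↔
      ∃ φ ψ : RatFunc ℂ, FirstOrderADE.IsRationalParametrization F φ ψ ∧
        (FirstOrderADE.ReducesToLinear φ ψ ∨ FirstOrderADE.ReducesToRiccati φ ψ)) ∧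
    -- reduction along any given rational parametrization
    (∀ φ ψ : RatFunc ℂ, FirstOrderADE.IsRationalParametrization F φ ψ →
      (FirstOrderADE.HasNonconstantRationalGeneralSolution F ↔
        (FirstOrderADE.ReducesToLinear φ ψ ∨ FirstOrderADE.ReducesToRiccati φ ψ))) ∧
    -- the general solution `1 / (z + λ)` of `u' + u ^ 2 = 0`
    FirstOrderADE.IsRationalGeneralSolution (MvPolynomial.X 1 + MvPolynomial.X 0 ^ 2)
      (1 / (FirstOrderADE.zVar + FirstOrderADE.lamVar)) := by
  open FirstOrderADE in
  refine ⟨?_, fun φ ψ hpar => ?_, isRationalGeneralSolution_riccati⟩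
  · rw [hasNonconstantRationalGeneralSolution_iff]
    refine ⟨fun ⟨f, hf, hFf⟩ => ⟨f, ratDeriv f,
      isRationalParametrization_of_solution hF hord hf hFf,
      Or.inl (reducesToLinear_ratDeriv hf)⟩, fun ⟨φ, ψ, hpar, hred⟩ =>
      exists_solution_of_reduces (aeval_eq_zero_of_isRationalParametrization hpar) hred⟩
  · rw [hasNonconstantRationalGeneralSolution_iff]
    exact ⟨fun ⟨f, hf, hFf⟩ => reduces_of_solution hF hord hpar hf hFf, fun hred =>
      exists_solution_of_reduces (aeval_eq_zero_of_isRationalParametrization hpar) hred⟩
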